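/- Let $d\ge 3$ and $q\ge 2$ be integers, and let $u_{1,q}=q$, $u_{k+1,q}=u_{k,q}(u_{k,q}+1)$ for $k\ge 1$. A $\frac1q$-lc Fano polytope in $\mathbb R^d$ is a polytope $P\subset\mathbb R^d$ with $0\in\operatorname{int}(P)$, all of whose vertices are primitive points of $\mathbb Z^d$, such that $\operatorname{int}(\frac1q P)\cap\mathbb Z^d=\{0\}$; it is minimal if for no vertex $v$ of $P$ the polytope $\operatorname{conv}((P\cap\mathbb Z^d)\setminus\{v\})$ is again a $\frac1q$-lc Fano polytope in $\mathbb R^d$. A $k$-dimensional $\frac1q$-lc Fano simplex in $\mathbb R^d$ is a $k$-dimensional polytope $S\subset\mathbb R^d$ with $k+1$ vertices, all of them primitive points of $\mathbb Z^d$, with $0\in\operatorname{relint}(S)$ and $\operatorname{relint}(\frac1q S)\cap\mathbb Z^d=\{0\}$. Let $P\subset\mathbb R^d$ be a minimal $\frac1q$-lc Fano polytope which is not a simplex, and suppose that $P$ decomposes into two $(d-1)$-dimensional $\frac1q$-lc Fano simplices, that is, $P=\operatorname{conv}(S_1\cup S_2)$ for two $(d-1)$-dimensional $\frac1q$-lc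 Fano simplices $S_1,S_2$ in $\mathbb R^d$ whose vertices are vertices of $P$. Let $P^*=\{m\in\mathbb R^d : \langle m,v\rangle+1\ge 0 \text{ for all } v\in P\}$ be the dual of $P$, and let $\operatorname{Vol}(P^*)$ be its normalized volume, that is, $d!$ times its Lebesgue measure. Then $$\operatorname{Vol}(P^*)<\frac{2u_{d,q}^2}{q^{d+1}}.$$ -/

import Mathlib

open scoped Pointwise

namespace LCFano

/-- The sequence `u_{1,q} = q`, `u_{k+1,q} = u_{k,q} (u_{k,q} + 1)`, indexed by `k ≥ 1`.
The value at `k = 0` is a dummy which plays no role. -/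
def u (q : ℕ) : ℕ → ℕ
  | 0 => 0
  | 1 => q
  | k + 2 => u q (k + 1) * (u q (k + 1) + 1)

/-- The lattice `ℤ^d` inside `ℝ^d`. -/
def lattice (d : ℕ) : Set (Fin d → ℝ) :=
  Set.range fun (z : Fin d → ℤ) (i : Fin d) => (z i : ℝ)

/-- `v` is a primitive lattice point: an integer vector whose coordinates have greatest
common divisor `1` (in particular `v ≠ 0`). -/
def IsPrimitive {d : ℕ} (v : Fin d → ℝ) : Prop :=
  ∃ z : Fin d → ℤ, v = (fun i => (z i : ℝ)) ∧ Finset.univ.gcd z = 1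

/-- A polytope: the convex hull of finitely many points. -/
def IsPolytope {d : ℕ} (P : Set (Fin d → ℝ)) : Prop :=
  ∃ F : Set (Fin d → ℝ), F.Finite ∧ P = convexHull ℝ F

/-- The vertices of `P`, that is, its extreme points. -/
def vert {d : ℕ} (P : Set (Fin d → ℝ)) : Set (Fin d → ℝ) :=
  Set.extremePoints ℝ P

/-- The dimension of the affine hull of `P`. -/
noncomputable def dim {d : ℕ} (P : Set (Fin d → ℝ)) : ℕ :=
  Module.finrank ℝ (vectorSpan ℝ P)

/-- A `k`-dimensional simplex in `ℝ^d`: a `k`-dimensional polytope with `k + 1` vertices. -/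
def IsSimplex {d : ℕ} (k : ℕ) (S : Set (Fin d → ℝ)) : Prop :=
  IsPolytope S ∧ dim S = k ∧ (vert S).ncard = k + 1

/-- The dual `P^* = {m | ⟨m, v⟩ + 1 ≥ 0 for all v ∈ P}`. -/
def dual {d : ℕ} (P : Set (Fin d → ℝ)) : Set (Fin d → ℝ) :=
  {m | ∀ v ∈ P, 0 ≤ m ⬝ᵥ v + 1}

/-- The normalized volume: `d!` times the Lebesgue measure on `ℝ^d`. -/
noncomputable def normalizedVolume {d : ℕ} (P : Set (Fin d → ℝ)) : ENNReal :=
  (d.factorial : ENNReal) * MeasureTheory.volume P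

/-- A `d`-dimensional `ε`-lc Fano polytope in `ℝ^d`: a polytope with the origin in its
interior, all of whose vertices are primitive lattice points, and such that the origin is
the only lattice point in the interior of `εP`. -/
structure IsLCFanoPolytope {d : ℕ} (ε : ℝ) (P : Set (Fin d → ℝ)) : Prop where
  isPolytope : IsPolytope P
  zero_mem : (0 : Fin d → ℝ) ∈ interior P
  primitive : ∀ v ∈ vert P, IsPrimitive v
  lc : interior (ε • P) ∩ lattice d = {0}

/-- A minimal `d`-dimensional `ε`-lc Fano polytope: for no vertex `v` is the convex hull of
the lattice points of `P` other than `v` still a `d`-dimensional `ε`-lc Fano polytope. -/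
def IsMinimalLCFanoPolytope {d : ℕ} (ε : ℝ) (P : Set (Fin d → ℝ)) : Prop :=
  IsLCFanoPolytope ε P ∧
    ∀ v ∈ vert P, ¬ IsLCFanoPolytope ε (convexHull ℝ ((P ∩ lattice d) \ {v}))

/-- A `k`-dimensional `ε`-lc Fano simplex `S` in `ℝ^d`, where `k` may be less than `d`: the
Fano and `ε`-lc conditions are taken inside the affine hull of `S`.  As this affine hull
contains the origin, it is a linear subspace `L`; its lattice is `L ∩ ℤ^d`, and a point of
`L ∩ ℤ^d` is primitive there if and only if it is primitive in `ℤ^d`. -/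
structure IsLCFanoSimplex {d : ℕ} (ε : ℝ) (k : ℕ) (S : Set (Fin d → ℝ)) : Prop where
  isSimplex : IsSimplex k S
  zero_mem : (0 : Fin d → ℝ) ∈ intrinsicInterior ℝ S
  primitive : ∀ v ∈ vert S, IsPrimitive v
  lc : intrinsicInterior ℝ (ε • S) ∩ lattice d = {0}

/-- `P` decomposes into two `ε`-lc Fano simplices of dimensions `k₁` and `k₂`: it is the
convex hull of their union, and their vertices are vertices of `P`. -/
def DecomposesIntoTwo {d : ℕ} (ε : ℝ) (k₁ k₂ : ℕ) (P : Set (Fin d → ℝ)) : Prop :=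
  ∃ S₁ S₂ : Set (Fin d → ℝ),
    IsLCFanoSimplex ε k₁ S₁ ∧ IsLCFanoSimplex ε k₂ S₂ ∧
    vert S₁ ⊆ vert P ∧ vert S₂ ⊆ vert P ∧
    P = convexHull ℝ (S₁ ∪ S₂)

end LCFano

/-! Write `n = d - 1`. On the dual of `P` the slacks `⟨m, v⟩ + 1` at the vertices are nonnegative,
and for each of the two simplices their average, weighted by the barycentric coordinates `β` of the
origin, is `1`. Take all vertices of `S₁` except the one of least weight, and one vertex `v₂ k` of
`S₂` outside the hyperplane spanned by `S₁`. These are `d` independent integer vectors, so their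
determinant is at least `1` in absolute value, and in the weighted slacks the dual lies in a prism
over a standard `n`-simplex. Hence its volume is at most `1 / (n! * B * β₂ k)`, where `B` is the
product of the `n` largest weights of `S₁` (`volume_dual_le`).

It remains to bound weights from below. By Minkowski's theorem, the absence of nonzero lattice
points in the relative interior of `S / q` forces `∏ β_i / q ≤ 1 - ∑ β_i` over every proper
subfamily (`prod_div_le_one_sub_sum`). Comparison with the Sylvester-type weights `q / (u_i + 1)`,
for which the initial subfamilies give equality, shows that the tails of the decreasing weights are
at least `q / u_{j+1,q}` (`div_uReal_le_tail`). This bounds `B` (`lt_mul_prod_weights`). It also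
gives `β₂ k ≥ q / (2 u_{d-1,q})`, since `v₂ k` can be chosen not to carry the least weight of `S₂`.
-/

namespace LCFano

open MeasureTheory

/-! ### Numerical inequalities: the sequence `u` and decreasing weights -/

/-- The real sequence `u_{k+1,q}`, indexed from `0`. -/
noncomputable def uReal (q k : ℕ) : ℝ := (u q (k + 1) : ℝ)

lemma uReal_zero (q : ℕ) : uReal q 0 = q := rfl

lemma uReal_succ (q k : ℕ) : uReal q (k + 1) = uReal q k * (uReal q k + 1) := by
  simp [uReal, u]

lemma uReal_pos {q : ℕ} (hq : 0 < q) (k : ℕ) : 0 < uReal q k := by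
  induction k with
  | zero => rw [uReal_zero]; exact_mod_cast hq
  | succ k ih => rw [uReal_succ]; positivity

/-- Telescoping: `q / (u + 1) = q / u - q / (u * (u + 1))`. -/
lemma sum_div_uReal_add_one {q : ℕ} (hq : 0 < q) (j : ℕ) :
    ∑ i ∈ Finset.range j, (q : ℝ) / (uReal q i + 1) = 1 - q / uReal q j := by
  have hq' : (0 : ℝ) < q := by exact_mod_cast hq
  induction j with
  | zero => simp [uReal_zero, hq'.ne']
  | succ j ih =>
    rw [Finset.sum_range_succ, ih, uReal_succ]
    have := uReal_pos hq j
    field_simp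
    ring

lemma prod_uReal_add_one {q : ℕ} (j : ℕ) :
    (q : ℝ) * ∏ i ∈ Finset.range j, (uReal q i + 1) = uReal q j := by
  induction j with
  | zero => simp [uReal_zero]
  | succ j ih => rw [Finset.prod_range_succ, ← mul_assoc, ih, uReal_succ]

lemma prod_inv_uReal_add_one {q : ℕ} (hq : 0 < q) (j : ℕ) :
    ∏ i ∈ Finset.range j, 1 / (uReal q i + 1) = q / uReal q j := by
  have hq' : (0 : ℝ) < q := by exact_mod_cast hq
  rw [← prod_uReal_add_one j]
  simp only [one_div, Finset.prod_inv_distrib]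
  field_simp

/-- Abel summation against a monotone weight. -/
lemma sum_mul_le_of_partial_sums_nonneg {e w : ℕ → ℝ} {j : ℕ}
    (hw : ∀ i < j, w i ≤ w (i + 1))
    (hD : ∀ k ≤ j, 0 ≤ ∑ i ∈ Finset.range k, e i) :
    ∑ i ∈ Finset.range (j + 1), e i * w i ≤ (∑ i ∈ Finset.range (j + 1), e i) * w j := by
  induction j with
  | zero => simp
  | succ j ih =>
    rw [Finset.sum_range_succ, Finset.sum_range_succ (f := e), add_mul]
    have h1 := ih (fun i hi => hw i (by omega)) (fun k hk => hD k (by omega))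
    have h2 := mul_le_mul_of_nonneg_left (hw j (by omega)) (hD (j + 1) le_rfl)
    linarith

/-- If the partial sums of `x` are dominated by those of `y` except for the last one, which
is strictly larger, then the product of `y` is smaller than that of the decreasing sequence `x`. -/
lemma prod_lt_prod_of_partial_sums {x y : ℕ → ℝ} {j : ℕ}
    (hx : ∀ i ≤ j, 0 < x i) (hy : ∀ i ≤ j, 0 < y i) (hanti : ∀ i < j, x (i + 1) ≤ x i)
    (hle : ∀ k ≤ j, ∑ i ∈ Finset.range k, x i ≤ ∑ i ∈ Finset.range k, y i)
    (hlt : ∑ i ∈ Finset.range (j + 1), y i < ∑ i ∈ Finset.range (j + 1), x i) :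
    ∏ i ∈ Finset.range (j + 1), y i < ∏ i ∈ Finset.range (j + 1), x i := by
  have hmem : ∀ {i}, i ∈ Finset.range (j + 1) → i ≤ j := fun h => by
    rw [Finset.mem_range] at h; omega
  have hA := sum_mul_le_of_partial_sums_nonneg (e := fun i => y i - x i) (w := fun i => (x i)⁻¹)
    (j := j) (fun i hi => inv_anti₀ (hx _ (by omega)) (hanti i hi))
    (fun k hk => by rw [Finset.sum_sub_distrib]; linarith [hle k hk])
  have hneg : ∑ i ∈ Finset.range (j + 1), (y i - x i) * (x i)⁻¹ < 0 := by
    refine hA.trans_lt (mul_neg_of_neg_of_pos ?_ (inv_pos.2 (hx j le_rfl)))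
    rw [Finset.sum_sub_distrib]; linarith
  -- From `1 + t ≤ exp t` with `1 + t = y i / x i`, the sign of the sum controls the product.
  have hprod : ∏ i ∈ Finset.range (j + 1), y i / x i < 1 := by
    calc ∏ i ∈ Finset.range (j + 1), y i / x i
        ≤ ∏ i ∈ Finset.range (j + 1), Real.exp ((y i - x i) * (x i)⁻¹) := by
          refine Finset.prod_le_prod (fun i hi => (div_pos (hy i (hmem hi)) (hx i (hmem hi))).le)
            fun i hi => ?_
          have := Real.add_one_le_exp ((y i - x i) * (x i)⁻¹)
          have h0 := hx i (hmem hi)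
          have h1 : y i / x i = (y i - x i) * (x i)⁻¹ + 1 := by field_simp; ring
          linarith
      _ = Real.exp (∑ i ∈ Finset.range (j + 1), (y i - x i) * (x i)⁻¹) := (Real.exp_sum _ _).symm
      _ < 1 := Real.exp_lt_one_iff.2 hneg
  rw [Finset.prod_div_distrib, div_lt_one (Finset.prod_pos fun i hi => hx i (hmem hi))] at hprod
  exact hprod

/-- The product-sum inequalities force the tails of a decreasing sequence of weights to be
at least `q / u_{j+1,q}`. -/
lemma div_uReal_le_tail {q n : ℕ} (hq : 0 < q) {b : ℕ → ℝ} (hb : ∀ i ≤ n, 0 < b i)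
    (hanti : ∀ i < n, b (i + 1) ≤ b i)
    (hprod : ∀ j ≤ n, ∏ i ∈ Finset.range j, b i / q ≤ 1 - ∑ i ∈ Finset.range j, b i) :
    ∀ j ≤ n, q / uReal q j ≤ 1 - ∑ i ∈ Finset.range j, b i := by
  have hq' : (0 : ℝ) < q := by exact_mod_cast hq
  intro j
  induction j using Nat.strong_induction_on with
  | _ j ih =>
    intro hj
    rcases j with _ | j
    · simp [uReal_zero, hq'.ne']
    by_contra! hlt
    have hs := sum_div_uReal_add_one hq
    -- The weights `q / (uReal q i + 1)` have tails exactly `q / uReal q k`. If `b` first violates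
    -- the bound at `j + 1`, its product exceeds theirs, whereas `hprod` and the short tail make it
    -- smaller.
    have key := prod_lt_prod_of_partial_sums (x := b) (y := fun i => q / (uReal q i + 1)) (j := j)
      (fun i hi => hb i (by omega)) (fun i _ => by have := uReal_pos hq i; positivity)
      (fun i hi => hanti i (by omega))
      (fun k hk => by rw [hs]; linarith [ih k (by omega) (by omega)])
      (by rw [hs]; linarith)
    have h1 := hprod (j + 1) hj
    have h2 := prod_inv_uReal_add_one hq (j + 1)
    rw [Finset.prod_div_distrib, Finset.prod_const] at h1 key
    rw [Finset.prod_div_distrib, Finset.prod_const_one] at h2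
    have h3 : (∏ i ∈ Finset.range (j + 1), b i) < (q / uReal q (j + 1)) * q ^ (j + 1) := by
      rw [Finset.card_range, div_le_iff₀ (by positivity)] at h1
      exact h1.trans_lt (mul_lt_mul_of_pos_right hlt (by positivity))
    rw [← h2, Finset.card_range] at *
    rw [one_div, mul_comm, ← div_eq_mul_inv] at h3
    exact lt_asymm h3 key

lemma prod_uReal_le {q : ℕ} (hq : 0 < q) (n : ℕ) :
    q * ∏ i ∈ Finset.range n, uReal q i ≤ uReal q n := by
  rw [← prod_uReal_add_one n]
  gcongr with i
  · exact fun i _ => (uReal_pos hq i).le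
  · linarith

/-- The restriction `3 ≤ n` matters: for `n = 2`, `q = 2` the two sides are `96` and `42`. -/
lemma factorial_mul_le_u {q n : ℕ} (hq : 2 ≤ q) (hn : 3 ≤ n) :
    (n + 2).factorial * (n + 2) ≤ u q (n + 1) := by
  induction n, hn using Nat.le_induction with
  | base =>
    have h : ∀ s, 6 ≤ s → 600 ≤ s * (s + 1) * (s * (s + 1) + 1) := fun s hs => by
      have : 42 ≤ s * (s + 1) := by nlinarith
      nlinarith
    have h6 : 6 ≤ q * (q + 1) := by nlinarith
    simpa [u, Nat.factorial] using h _ h6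
  | succ n hn ih =>
    have : u q (n + 1 + 1) = u q (n + 1) * (u q (n + 1) + 1) := rfl
    rw [this, Nat.factorial_succ]
    have hf : n + 2 ≤ (n + 2).factorial := Nat.self_le_factorial _
    have h1 : n + 5 ≤ u q (n + 1) + 1 := by nlinarith
    have h2 : (n + 3) * (n + 3) ≤ (n + 2) * (u q (n + 1) + 1) := by nlinarith
    calc (n + 1 + 1 + 1) * (n + 2).factorial * (n + 1 + 2)
        = (n + 2).factorial * ((n + 3) * (n + 3)) := by ring
      _ ≤ (n + 2).factorial * ((n + 2) * (u q (n + 1) + 1)) := by gcongr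
      _ = ((n + 2).factorial * (n + 2)) * (u q (n + 1) + 1) := by ring
      _ ≤ _ := by gcongr

/-- The tail has `n + 1 - j` terms, of which `b j` is the largest. -/
lemma one_sub_sum_le_mul {n : ℕ} {b : ℕ → ℝ} (hanti : ∀ i < n, b (i + 1) ≤ b i)
    (hsum : ∑ i ∈ Finset.range (n + 1), b i = 1) {j : ℕ} (hj : j ≤ n) :
    1 - ∑ i ∈ Finset.range j, b i ≤ (n + 1 - j : ℕ) * b j := by
  have hle : ∀ i, j ≤ i → i ≤ n → b i ≤ b j := by
    intro i hi
    induction i, hi using Nat.le_induction with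
    | base => exact fun _ => le_rfl
    | succ i hi ih => exact fun h => (hanti i (by omega)).trans (ih (by omega))
  rw [← hsum, ← Finset.sum_Ico_eq_sub _ (by omega)]
  calc ∑ i ∈ Finset.Ico j (n + 1), b i ≤ ∑ i ∈ Finset.Ico j (n + 1), b j :=
        Finset.sum_le_sum fun i hi => by
          rw [Finset.mem_Ico] at hi; exact hle i hi.1 (by omega)
    _ = _ := by rw [Finset.sum_const, Nat.card_Ico, nsmul_eq_mul]

/-- The numerical core: a lower bound for the product of all but the smallest of the weights. -/
lemma lt_mul_prod_weights {q m : ℕ} (hq : 2 ≤ q) (hm : 1 ≤ m) {b : ℕ → ℝ}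
    (hb : ∀ i ≤ m + 1, 0 < b i) (hanti : ∀ i < m + 1, b (i + 1) ≤ b i)
    (hsum : ∑ i ∈ Finset.range (m + 2), b i = 1)
    (htail : ∀ j ≤ m + 1, q / uReal q j ≤ 1 - ∑ i ∈ Finset.range j, b i) :
    (m + 2) * (q : ℝ) ^ (m + 2) <
      uReal q m * (uReal q m + 1) ^ 2 * ∏ i ∈ Finset.range (m + 1), b i := by
  have hq0 : 0 < q := by omega
  have hq' : (2 : ℝ) ≤ q := by exact_mod_cast hq
  have hU := uReal_pos hq0
  have hmul := fun j (hj : j ≤ m + 1) => one_sub_sum_le_mul hanti hsum hj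
  have hb0 := hb 0 (by omega)
  have h0 := hmul 0 (by omega)
  have h1 := htail 1 (by omega)
  have h1' := hmul 1 (by omega)
  have hU1 : uReal q 1 = q * (q + 1) := by rw [uReal_succ, uReal_zero]
  -- If `uReal q m` absorbs the factorial, the termwise bounds `b i ≥ q / ((m + 2 - i) * uReal q i)`
  -- suffice. Otherwise only small cases remain, where they are too weak.
  by_cases hbig : ((m + 2).factorial * (m + 2) : ℝ) ≤ uReal q m
  · have hprod : (q : ℝ) ^ (m + 1) / ((m + 2).factorial * ∏ i ∈ Finset.range (m + 1), uReal q i)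
        ≤ ∏ i ∈ Finset.range (m + 1), b i := by
      have hfac : ((m + 2).factorial : ℝ) = ∏ i ∈ Finset.range (m + 1), ((m + 2 - i : ℕ) : ℝ) := by
        rw [← Nat.factorial_mul_descFactorial (show m + 1 ≤ m + 2 by omega),
          Nat.descFactorial_eq_prod_range]
        simp
      have hq1 : (q : ℝ) ^ (m + 1) = ∏ i ∈ Finset.range (m + 1), (q : ℝ) := by simp
      rw [hfac, hq1, ← Finset.prod_mul_distrib, ← Finset.prod_div_distrib]
      refine Finset.prod_le_prod (fun i _ => by have := hU i; positivity) fun i hi => ?_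
      rw [Finset.mem_range] at hi
      have hpos : (0 : ℝ) < (m + 2 - i : ℕ) := by exact_mod_cast (by omega : 0 < m + 2 - i)
      have h := (htail i (by omega)).trans (hmul i (by omega))
      have := hU i
      rw [div_le_iff₀ this] at h
      rw [div_le_iff₀ (by positivity)]
      calc (q : ℝ) ≤ _ := h
        _ = _ := by rw [show m + 1 + 1 - i = m + 2 - i by omega]; ring
    have hPU : (q : ℝ) * ∏ i ∈ Finset.range (m + 1), uReal q i ≤ uReal q m * uReal q m := by
      rw [Finset.prod_range_succ, ← mul_assoc]
      exact mul_le_mul_of_nonneg_right (prod_uReal_le hq0 m) (hU m).le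
    have hPpos : 0 < ∏ i ∈ Finset.range (m + 1), uReal q i := Finset.prod_pos fun i _ => hU i
    have hfpos : (0 : ℝ) < (m + 2).factorial := by exact_mod_cast Nat.factorial_pos _
    rw [div_le_iff₀ (by positivity)] at hprod
    set W := uReal q m
    have hW : 0 < W := hU m
    set B := ∏ i ∈ Finset.range (m + 1), b i
    have hB : 0 < B := Finset.prod_pos fun i hi => hb i (by rw [Finset.mem_range] at hi; omega)
    set F : ℝ := ((m + 2).factorial : ℝ)
    set Pu := ∏ i ∈ Finset.range (m + 1), uReal q i
    calc (m + 2) * (q : ℝ) ^ (m + 2) = (m + 2) * (q * (q : ℝ) ^ (m + 1)) := by ring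
      _ ≤ (m + 2) * (q * (B * (F * Pu))) := by gcongr
      _ = (F * (m + 2)) * ((q * Pu) * B) := by ring
      _ ≤ W * ((W * W) * B) := by gcongr
      _ < W * ((W + 1) ^ 2 * B) := by gcongr; nlinarith
      _ = _ := by ring
  · have hsmall : m = 1 ∨ (m = 2 ∧ q = 2) := by
      by_contra! hne
      refine hbig ?_
      rcases (show 3 ≤ m ∨ m = 2 by omega) with h | rfl
      · show _ ≤ ((u q (m + 1) : ℕ) : ℝ)
        exact_mod_cast factorial_mul_le_u hq h
      · have : 3 ≤ q := by have := hne.2 rfl; omega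
        have h12 : 12 ≤ q * (q + 1) := by nlinarith
        have h156 : ∀ s : ℕ, 12 ≤ s → 96 ≤ s * (s + 1) := fun s hs => by nlinarith
        have : (2 + 2).factorial * (2 + 2) ≤ u q (2 + 1) := by
          simpa [u, Nat.factorial] using h156 _ h12
        show _ ≤ ((u q (2 + 1) : ℕ) : ℝ)
        exact_mod_cast this
    rw [Finset.sum_range_one] at h1 h1'
    rw [hU1] at h1
    have hq3 : q / (q * (q + 1) : ℝ) = 1 / (q + 1) := by field_simp
    rw [hq3, div_le_iff₀ (by positivity)] at h1
    rcases hsmall with rfl | ⟨rfl, rfl⟩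
    · norm_num [Finset.prod_range_succ] at h0 h1' ⊢
      rw [hU1]
      -- Since `b 0` lies between `1 / (q + 1)` and `q / (q + 1)`, concavity gives `b 0 * (1 - b 0)
      -- ≥ q / (q + 1) ^ 2`; moreover `1 - b 0 ≤ 2 * b 1`.
      have hlow : (q : ℝ) ≤ 2 * (q + 1) ^ 2 * (b 0 * b 1) := by
        have hc : (q : ℝ) ≤ (q + 1) ^ 2 * (b 0 * (1 - b 0)) := by
          have ha : 0 ≤ ((q : ℝ) + 1) * b 0 - 1 := by nlinarith
          nlinarith [mul_nonneg ha (sub_nonneg.2 h1)]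
        nlinarith [mul_le_mul_of_nonneg_left h1' hb0.le, sq_nonneg ((q : ℝ) + 1)]
      have hs : 6 * ((q : ℝ) * (q + 1)) < (q * (q + 1) + 1) ^ 2 := by
        have : (6 : ℝ) ≤ q * (q + 1) := by nlinarith
        nlinarith
      have hb1 := hb 1 (by omega)
      calc 3 * (q : ℝ) ^ 3 = (3 * q ^ 2) * q := by ring
        _ ≤ (3 * q ^ 2) * (2 * (q + 1) ^ 2 * (b 0 * b 1)) := by gcongr
        _ = (6 * (q * (q + 1))) * (q * (q + 1) * (b 0 * b 1)) := by ring
        _ < (q * (q + 1) + 1) ^ 2 * (q * (q + 1) * (b 0 * b 1)) := by gcongr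
        _ = q * (q + 1) * (q * (q + 1) + 1) ^ 2 * (b 0 * b 1) := by ring
    · have h2 := htail 2 (by omega)
      have h2' := hmul 2 (by omega)
      have hb1 := hb 1 (by omega)
      have hU2 : uReal 2 2 = 42 := by rw [uReal_succ, hU1]; norm_num
      norm_num [Finset.prod_range_succ, Finset.sum_range_succ, hU2] at h0 h1 h1' h2 h2' ⊢
      -- Here `1 / 4 ≤ b 0 ≤ 2 / 3` and `1 - b 0 ≤ 3 * b 1`; the concave function `b 0 * (1 - b 0) /
      -- 3` is least at `b 0 = 1 / 4`.
      have h01 : 1 / 16 ≤ b 0 * b 1 := by nlinarith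
      nlinarith [mul_le_mul h01 (show (1 / 42 : ℝ) ≤ b 2 by linarith) (by norm_num) (by nlinarith)]

/-! ### Geometry of numbers: the product-sum inequality -/

/-- Minkowski's theorem on linear forms. -/
lemma exists_int_abs_mulVec_lt {J : Type*} [Fintype J] [DecidableEq J] (A : Matrix J J ℝ)
    (hA : A.det ≠ 0) {c : J → ℝ} (hc : ∀ i, 0 < c i) (h : |A.det| < ∏ i, c i) :
    ∃ z : J → ℤ, z ≠ 0 ∧ ∀ i, |A.mulVec (fun k => (z k : ℝ)) i| < c i := by
  set f := Matrix.toLin' A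
  have hf : LinearMap.det f ≠ 0 := by rwa [LinearMap.det_toLin']
  set K : Set (J → ℝ) := Set.univ.pi fun i => Set.Ioo (-c i) (c i)
  have hK : volume K = ENNReal.ofReal (2 ^ Fintype.card J * ∏ i, c i) := by
    rw [Real.volume_pi_Ioo, ← ENNReal.ofReal_prod_of_nonneg fun i _ => by linarith [hc i]]
    congr 1
    rw [← Finset.card_univ, ← Finset.prod_const, ← Finset.prod_mul_distrib]
    exact Finset.prod_congr rfl fun i _ => by ring
  have hKconv : Convex ℝ K := convex_pi fun i _ => convex_Ioo _ _
  have hKsymm : ∀ x ∈ K, -x ∈ K := fun x hx i hi => by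
    have := hx i hi
    rw [Set.mem_Ioo] at this
    rw [Pi.neg_apply, Set.mem_Ioo]
    constructor <;> linarith [this.1, this.2]
  have hvol : volume (f ⁻¹' K) = ENNReal.ofReal (|A.det|⁻¹ * (2 ^ Fintype.card J * ∏ i, c i)) := by
    rw [Measure.addHaar_preimage_linearMap volume hf, hK, LinearMap.det_toLin', abs_inv,
      ← ENNReal.ofReal_mul (by positivity)]
  have : Countable (Submodule.span ℤ (Set.range (Pi.basisFun ℝ J))).toAddSubgroup :=
    inferInstanceAs (Countable (Submodule.span ℤ (Set.range (Pi.basisFun ℝ J))))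
  obtain ⟨x, hx0, hx⟩ := exists_ne_zero_mem_lattice_of_measure_mul_two_pow_lt_measure
    (ZSpan.isAddFundamentalDomain' (Pi.basisFun ℝ J) volume)
    (fun x hx => by
      rw [Set.mem_preimage] at hx ⊢
      rw [map_neg]
      exact hKsymm _ hx)
    (hKconv.linear_preimage f) (by
      have h1 : Matrix.of ⇑(Pi.basisFun ℝ J) = 1 := by
        ext i j
        simp [Matrix.one_apply, Pi.single_apply, eq_comm]
      rw [hvol, ZSpan.volume_fundamentalDomain, h1, Matrix.det_one, abs_one, ENNReal.ofReal_one,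
        one_mul, Module.finrank_fintype_fun_eq_card,
        show (2 : ENNReal) = ENNReal.ofReal 2 by simp, ← ENNReal.ofReal_pow (by norm_num),
        ENNReal.ofReal_lt_ofReal_iff_of_nonneg (by positivity), mul_left_comm]
      have : 1 < |A.det|⁻¹ * ∏ i, c i := by
        rwa [← div_eq_inv_mul, one_lt_div (abs_pos.2 hA)]
      nlinarith [pow_pos (two_pos (α := ℝ)) (Fintype.card J)])
  have hmem := (Module.Basis.mem_span_iff_repr_mem ℤ (Pi.basisFun ℝ J) (x : J → ℝ)).1 x.2
  choose z hz using hmem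
  have hzx : (fun k => (z k : ℝ)) = (x : J → ℝ) := by
    funext k
    simpa using hz k
  refine ⟨z, ?_, fun i => ?_⟩
  · rintro rfl
    refine hx0 (Subtype.ext ?_)
    rw [← hzx]
    simp
    rfl
  · have := hx i (Set.mem_univ i)
    rw [hzx, abs_lt]
    exact this

/-- The matrix `β 1ᵀ - 1` has determinant `±(1 - ∑ β)`. -/
lemma abs_det_col_sub_one {J : Type*} [Fintype J] [DecidableEq J] (β : J → ℝ) :
    |(Matrix.of fun i k : J => β i - if i = k then 1 else 0).det| = |1 - ∑ i, β i| := by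
  have h : (Matrix.of fun i k : J => β i - if i = k then (1 : ℝ) else 0) =
      -(1 + Matrix.replicateCol Unit β * Matrix.replicateRow Unit fun _ => (-1 : ℝ)) := by
    ext i k
    simp [Matrix.mul_apply, Matrix.one_apply]
    ring
  rw [h, Matrix.det_neg, Matrix.det_one_add_replicateCol_mul_replicateRow, abs_mul, abs_pow,
    abs_neg, abs_one, one_pow, one_mul]
  simp [dotProduct, sub_eq_add_neg]

lemma sum_eq_sum_coe {ι M : Type*} [Fintype ι] [AddCommMonoid M] (J : Finset ι) {g : ι → M}
    (hg : ∀ i ∉ J, g i = 0) : ∑ i, g i = ∑ i : J, g i := by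
  rw [Finset.sum_coe_sort J g]
  exact (Finset.sum_subset (Finset.subset_univ _) fun i _ hi => hg i hi).symm

/-- The product-sum inequality for the barycentric coordinates of the origin: if the only lattice
point with positive barycentric coordinates of sum `1 / q` is the origin, then every proper
subfamily of the barycentric coordinates satisfies `∏ (β_i / q) ≤ 1 - ∑ β_i`. -/
lemma prod_div_le_one_sub_sum {ι E : Type*} [Fintype ι] [DecidableEq ι] [AddCommGroup E]
    [Module ℝ E] {q : ℕ} (hq : 0 < q) {v : ι → E} {β : ι → ℝ} (hβ : ∀ i, 0 < β i)
    (hβs : ∑ i, β i = 1) (hβv : ∑ i, β i • v i = 0)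
    (hlc : ∀ (α : ι → ℝ) (h : ι → ℤ), (∀ i, 0 < α i) → ∑ i, α i = 1 / q →
      ∑ i, α i • v i = ∑ i, (h i : ℝ) • v i → ∑ i, (h i : ℝ) • v i = 0)
    {J : Finset ι} (hJ : LinearIndependent ℝ fun i : J => v i) (hJne : J ≠ Finset.univ) :
    ∏ i ∈ J, β i / q ≤ 1 - ∑ i ∈ J, β i := by
  have hq' : (0 : ℝ) < q := by exact_mod_cast hq
  have hlt : ∑ i ∈ J, β i < 1 := by
    rw [← hβs]
    obtain ⟨k, hk⟩ : ∃ k, k ∉ J := by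
      by_contra! hall
      exact hJne (Finset.eq_univ_iff_forall.2 hall)
    exact Finset.sum_lt_sum_of_subset (Finset.subset_univ _) (Finset.mem_univ k) hk (hβ k)
      fun i _ _ => (hβ i).le
  by_contra! hcon
  set A : Matrix J J ℝ := Matrix.of fun i k : J => β i - if i = k then 1 else 0
  have hdet : |A.det| = 1 - ∑ i ∈ J, β i := by
    rw [abs_det_col_sub_one fun i : J => β i, Finset.sum_coe_sort J β,
      abs_of_pos (by linarith)]
  obtain ⟨z, hz0, hz⟩ := exists_int_abs_mulVec_lt A
    (abs_pos.1 (by rw [hdet]; linarith)) (c := fun i : J => β i / q)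
    (fun i => div_pos (hβ i) hq')
    (by rw [hdet, Finset.prod_coe_sort J fun i => β i / q]; exact hcon)
  have hzA : ∀ y : J → ℤ, ∀ i : J, A.mulVec (fun k => (y k : ℝ)) i
      = (∑ k, (y k : ℝ)) * β i - y i := by
    intro y i
    simp only [A, Matrix.mulVec, dotProduct, Matrix.of_apply, sub_mul, Finset.sum_sub_distrib,
      ← Finset.mul_sum, ite_mul, one_mul, zero_mul, Finset.sum_ite_eq, Finset.mem_univ, if_true]
    ring
  simp only [hzA] at hz
  -- Replacing `z` by `-z` if needed makes the coordinate sum nonnegative, which keeps the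
  -- coordinates outside `J` positive below.
  obtain ⟨y, hy0, hy, hT⟩ : ∃ y : J → ℤ, y ≠ 0 ∧
      (∀ i : J, |(∑ k, (y k : ℝ)) * β i - y i| < β i / q) ∧ 0 ≤ ∑ k, (y k : ℝ) := by
    rcases le_total 0 (∑ k, (z k : ℝ)) with h | h
    · exact ⟨z, hz0, hz, h⟩
    · refine ⟨-z, neg_ne_zero.2 hz0, fun i => ?_, ?_⟩
      · rw [← abs_neg]
        convert hz i using 2
        simp
        ring
      · simpa using h
  set T := ∑ k, (y k : ℝ)
  set h : ι → ℤ := fun i => if hi : i ∈ J then -y ⟨i, hi⟩ else 0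
  have hhJ : ∀ i : J, h i = -y i := fun i => by simp [h]
  have hhn : ∀ i ∉ J, h i = 0 := fun i hi => by simp [h, hi]
  have hsh : ∑ i, (h i : ℝ) = -T := by
    rw [sum_eq_sum_coe J (g := fun i => (h i : ℝ)) fun i hi => by simp [hhn i hi]]
    simp [hhJ, T]
  -- The lattice point `-∑ y_i v_i` is rewritten by adding `(T + 1 / q) * ∑ β_i v_i = 0`. The
  -- Minkowski bound makes its new coordinates positive on `J`, and their sum is `1 / q`.
  have hzero : ∑ i, (h i : ℝ) • v i = 0 := by
    refine hlc (fun i => (T + 1 / q) * β i + h i) h (fun i => ?_) ?_ ?_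
    · by_cases hi : i ∈ J
      · have h1 := (abs_lt.1 (hy ⟨i, hi⟩)).1
        have h2 := hhJ ⟨i, hi⟩
        simp only at h1 h2 ⊢
        rw [h2]
        push_cast
        have : (T + 1 / q) * β i = T * β i + β i / q := by ring
        linarith
      · have := hβ i
        simp only [hhn i hi, Int.cast_zero, add_zero]
        positivity
    · rw [Finset.sum_add_distrib, ← Finset.mul_sum, hβs, hsh]
      ring
    · simp only [add_smul, mul_smul, Finset.sum_add_distrib]
      rw [add_eq_right]
      simp only [← Finset.smul_sum, hβv, smul_zero, add_zero]
  rw [sum_eq_sum_coe J (g := fun i => (h i : ℝ) • v i) fun i hi => by simp [hhn i hi]] at hzero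
  have := Fintype.linearIndependent_iff.1 hJ _ hzero
  refine hy0 (funext fun i => ?_)
  have h1 := this i
  rw [hhJ] at h1
  simpa using h1

/-! ### Polytopes, barycentric coordinates and relative interiors -/

lemma IsPolytope.finite_vert {d : ℕ} {P : Set (Fin d → ℝ)} (hP : IsPolytope P) :
    (vert P).Finite := by
  obtain ⟨F, hF, rfl⟩ := hP
  exact hF.subset extremePoints_convexHull_subset

lemma IsPolytope.convexHull_vert {d : ℕ} {P : Set (Fin d → ℝ)} (hP : IsPolytope P) :
    convexHull ℝ (vert P) = P := by
  have hfin := hP.finite_vert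
  obtain ⟨F, hF, rfl⟩ := hP
  rw [← (hfin.isClosed_convexHull ℝ).closure_eq]
  exact closure_convexHull_extremePoints (hF.isCompact_convexHull ℝ) (convex_convexHull ℝ F)

lemma mem_convexHull_range_iff {ι E : Type*} [Fintype ι] [AddCommGroup E] [Module ℝ E]
    {v : ι → E} {x : E} :
    x ∈ convexHull ℝ (Set.range v) ↔
      ∃ w : ι → ℝ, (∀ i, 0 ≤ w i) ∧ ∑ i, w i = 1 ∧ ∑ i, w i • v i = x := by
  classical
  have h : Set.range v = Fintype.linearCombination ℝ v '' Set.range fun i j : ι =>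
      if i = j then (1 : ℝ) else 0 := by
    rw [← Set.range_comp]
    congr 1
    funext i
    simp [Fintype.linearCombination_apply]
  rw [h, ← LinearMap.image_convexHull, convexHull_basis_eq_stdSimplex]
  simp only [Set.mem_image, stdSimplex, Set.mem_ofPred_eq, Fintype.linearCombination_apply,
    and_assoc]

/-- From the origin, a relative interior point, one can move a little away from any point. -/
lemma exists_neg_smul_mem {E : Type*} [NormedAddCommGroup E] [NormedSpace ℝ E] {S : Set E}
    (h0 : (0 : E) ∈ intrinsicInterior ℝ S) {w : E} (hw : w ∈ S) :
    ∃ δ : ℝ, 0 < δ ∧ -(δ • w) ∈ S := by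
  obtain ⟨y, hy, hy0⟩ := mem_intrinsicInterior.1 h0
  have h0S : (0 : E) ∈ affineSpan ℝ S := hy0 ▸ y.2
  have hmem : ∀ δ : ℝ, -(δ • w) ∈ affineSpan ℝ S := fun δ => by
    have := AffineMap.lineMap_mem (-δ) h0S (subset_affineSpan ℝ S hw)
    simpa [AffineMap.lineMap_apply] using this
  set γ : ℝ → affineSpan ℝ S := fun δ => ⟨-(δ • w), hmem δ⟩
  have hγ : Continuous γ := by
    refine Continuous.subtype_mk ?_ _
    fun_prop
  have hγ0 : γ 0 = y := Subtype.ext (by simp [γ, hy0])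
  have hev : ∀ᶠ δ in nhds (0 : ℝ), γ δ ∈ interior (Subtype.val ⁻¹' S : Set (affineSpan ℝ S)) :=
    hγ.continuousAt.eventually_mem (by rw [hγ0]; exact isOpen_interior.mem_nhds hy)
  obtain ⟨δ, hδ, hδ0⟩ := ((hev.filter_mono nhdsWithin_le_nhds).and
    (self_mem_nhdsWithin : Set.Ioi (0 : ℝ) ∈ nhdsWithin 0 (Set.Ioi 0))).exists
  exact ⟨δ, hδ0, show γ δ ∈ (Subtype.val ⁻¹' S : Set _) from interior_subset hδ⟩

/-- A relative interior origin is a positive convex combination of all the generators. -/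
lemma exists_pos_barycentric {ι E : Type*} [Fintype ι] [Nonempty ι] [NormedAddCommGroup E]
    [NormedSpace ℝ E] {v : ι → E}
    (h0 : (0 : E) ∈ intrinsicInterior ℝ (convexHull ℝ (Set.range v))) :
    ∃ β : ι → ℝ, (∀ i, 0 < β i) ∧ ∑ i, β i = 1 ∧ ∑ i, β i • v i = 0 := by
  classical
  -- Writing `-(δ • v i)` as a convex combination gives a nonnegative relation with positive `i`-th
  -- coefficient; the sum of these relations over `i` is positive everywhere.
  have h : ∀ i, ∃ c : ι → ℝ, (∀ j, 0 ≤ c j) ∧ 0 < c i ∧ ∑ j, c j • v j = 0 := fun i => by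
    obtain ⟨δ, hδ, hmem⟩ := exists_neg_smul_mem h0 (subset_convexHull ℝ _ (Set.mem_range_self i))
    obtain ⟨w, hw, -, hwv⟩ := mem_convexHull_range_iff.1 hmem
    refine ⟨fun j => w j + if j = i then δ else 0, fun j => ?_, ?_, ?_⟩
    · have := hw j
      dsimp only
      split_ifs <;> linarith
    · have := hw i
      simp only [if_true]
      linarith
    · simp [add_smul, Finset.sum_add_distrib, hwv, ite_smul]
  choose c hc hci hcv using h
  set t : ι → ℝ := fun j => ∑ i, c i j
  have ht : ∀ j, 0 < t j := fun j =>
    Finset.sum_pos' (fun i _ => hc i j) ⟨j, Finset.mem_univ j, hci j⟩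
  have htv : ∑ j, t j • v j = 0 := by
    simp only [t, Finset.sum_smul]
    rw [Finset.sum_comm]
    exact Finset.sum_eq_zero fun i _ => hcv i
  have hs : 0 < ∑ j, t j := Finset.sum_pos (fun j _ => ht j) Finset.univ_nonempty
  refine ⟨fun j => (∑ j, t j)⁻¹ * t j, fun j => mul_pos (inv_pos.2 hs) (ht j), ?_, ?_⟩
  · rw [← Finset.mul_sum, inv_mul_cancel₀ hs.ne']
  · simp only [mul_smul, ← Finset.smul_sum, htv, smul_zero]

/-- Points with positive barycentric coordinates of sum `ε` lie in the relative interior of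
`ε S`, for a polytope `S` with the origin in its relative interior. -/
lemma sum_smul_mem_intrinsicInterior {ι E : Type*} [Fintype ι] [NormedAddCommGroup E]
    [NormedSpace ℝ E] [FiniteDimensional ℝ E] {v : ι → E} {ε : ℝ}
    (hε : 0 < ε) {β : ι → ℝ} (hβs : ∑ i, β i = 1)
    (hβv : ∑ i, β i • v i = 0) {α : ι → ℝ} (hα : ∀ i, 0 < α i) (hαs : ∑ i, α i = ε) :
    ∑ i, α i • v i ∈ intrinsicInterior ℝ (ε • convexHull ℝ (Set.range v)) := by
  set φ := Fintype.linearCombination ℝ v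
  have hφ : ∀ c, φ c = ∑ i, c i • v i := fun c => Fintype.linearCombination_apply ℝ v c
  -- A linear section of `φ` over its range, extended to `E`, gives coordinates depending
  -- continuously on the point.
  obtain ⟨g₀, hg₀⟩ := φ.rangeRestrict.exists_rightInverse_of_surjective φ.range_rangeRestrict
  obtain ⟨g, hg⟩ := LinearMap.exists_extend g₀
  have hφg : ∀ x ∈ φ.range, φ (g x) = x := fun x hx => by
    have h1 : g x = g₀ ⟨x, hx⟩ := congrArg (fun f => f ⟨x, hx⟩) hg
    rw [h1]
    exact congrArg Subtype.val (congrArg (fun f => f ⟨x, hx⟩) hg₀)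
  have hgc : Continuous g := g.continuous_of_finiteDimensional
  set y := ∑ i, α i • v i
  have hy : y ∈ φ.range := ⟨α, hφ α⟩
  set c : E → ι → ℝ := fun x => α + g (x - y)
  -- Adding a multiple of `β` restores the coordinate sum `ε` without moving the point, because `∑
  -- β_i v_i = 0`; positivity of the corrected coordinates is an open condition.
  set O : Set E := {x | ∀ i, 0 < c x i + (ε - ∑ k, c x k) * β i}
  have hO : IsOpen O := by
    simp only [O, Set.ofPred_forall]
    refine isOpen_iInter_of_finite fun i => isOpen_lt continuous_const ?_
    have hc : Continuous c := continuous_const.add (hgc.comp (continuous_id.sub continuous_const))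
    fun_prop
  have hcone : ∀ a : ι → ℝ, (∀ i, 0 < a i) → ∑ i, a i = ε →
      ∑ i, a i • v i ∈ ε • convexHull ℝ (Set.range v) := fun a ha has => by
    refine Set.mem_smul_set.2 ⟨ε⁻¹ • ∑ i, a i • v i, mem_convexHull_range_iff.2
      ⟨fun i => ε⁻¹ * a i, fun i => (mul_pos (inv_pos.2 hε) (ha i)).le, ?_, ?_⟩,
      smul_inv_smul₀ hε.ne' _⟩
    · rw [← Finset.mul_sum, has, inv_mul_cancel₀ hε.ne']
    · simp only [mul_smul, ← Finset.smul_sum]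
  have hspan : (affineSpan ℝ (ε • convexHull ℝ (Set.range v)) : Set E) ⊆ φ.range := by
    refine (affineSpan_subset_span).trans ?_
    rw [SetLike.coe_subset_coe, Submodule.span_le]
    rintro _ ⟨x, hx, rfl⟩
    obtain ⟨w, -, -, rfl⟩ := mem_convexHull_range_iff.1 hx
    exact ⟨ε • w, by simp [hφ, Finset.smul_sum, mul_smul]⟩
  have hsub : ∀ x ∈ O, x ∈ φ.range → x ∈ ε • convexHull ℝ (Set.range v) := fun x hxO hx => by
    have hx' : ∑ i, (c x i + (ε - ∑ k, c x k) * β i) • v i = x := by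
      simp only [add_smul, mul_smul, Finset.sum_add_distrib]
      rw [← Finset.smul_sum, hβv, smul_zero, add_zero, ← hφ]
      simp only [c, map_add, hφ α, hφg _ (Submodule.sub_mem _ hx hy)]
      exact add_sub_cancel y x
    rw [← hx']
    refine hcone _ hxO ?_
    rw [Finset.sum_add_distrib, ← Finset.mul_sum, hβs]
    ring
  have hyO : y ∈ O := fun i => by simpa [c, hαs] using hα i
  refine mem_intrinsicInterior.2 ⟨⟨y, subset_affineSpan ℝ _ (hcone α hα hαs)⟩, ?_, rfl⟩
  refine mem_interior.2 ⟨Subtype.val ⁻¹' O, fun x hx => hsub x hx (hspan x.2),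
    hO.preimage continuous_subtype_val, hyO⟩

/-! ### Fano simplices with sorted weights -/

/-- The data of a `1/q`-lc Fano simplex: its vertices, and the barycentric coordinates of the
origin in decreasing order. -/
structure IsSortedFanoSimplex {d : ℕ} (q n : ℕ) (S : Set (Fin d → ℝ))
    (z : Fin (n + 1) → Fin d → ℤ) (v : Fin (n + 1) → Fin d → ℝ) (β : Fin (n + 1) → ℝ) : Prop where
  cast : ∀ i, v i = fun k => (z i k : ℝ)
  eq_convexHull : S = convexHull ℝ (Set.range v)
  pos : ∀ i, 0 < β i
  anti : Antitone β
  sum_eq : ∑ i, β i = 1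
  sum_smul : ∑ i, β i • v i = 0
  finrank_span : Module.finrank ℝ (Submodule.span ℝ (Set.range v)) = n
  lc : ∀ (α : Fin (n + 1) → ℝ) (h : Fin (n + 1) → ℤ), (∀ i, 0 < α i) → ∑ i, α i = 1 / q →
    ∑ i, α i • v i = ∑ i, (h i : ℝ) • v i → ∑ i, (h i : ℝ) • v i = 0

lemma span_convexHull_range {ι E : Type*} [AddCommGroup E] [Module ℝ E] (v : ι → E) :
    Submodule.span ℝ (convexHull ℝ (Set.range v)) = Submodule.span ℝ (Set.range v) := by
  refine le_antisymm (Submodule.span_le.2 ?_) (Submodule.span_mono (subset_convexHull ℝ _))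
  exact convexHull_min Submodule.subset_span (Submodule.convex _)

lemma IsLCFanoSimplex.exists_sorted {d q n : ℕ} (hq : 0 < q) {S : Set (Fin d → ℝ)}
    (hS : IsLCFanoSimplex (1 / (q : ℝ)) n S) :
    ∃ z v β, IsSortedFanoSimplex q n S z v β := by
  have hq' : (0 : ℝ) < 1 / q := by positivity
  obtain ⟨⟨hpoly, hdim, hcard⟩, h0, hprim, hlc⟩ := hS
  have : Finite (vert S) := hpoly.finite_vert
  let e := (Finite.equivFinOfCardEq (α := vert S) (n := n + 1) hcard).symm
  have hr : Set.range (fun i => (e i : Fin d → ℝ)) = vert S := by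
    rw [show (fun i => (e i : Fin d → ℝ)) = Subtype.val ∘ e from rfl, e.surjective.range_comp,
      Subtype.range_coe]
  have hconv := hpoly.convexHull_vert
  rw [← hr] at hconv
  obtain ⟨β, hβ, hβs, hβv⟩ := exists_pos_barycentric (hconv.symm ▸ h0)
  let σ := Tuple.sort fun i => -β i
  have hσ : Antitone (β ∘ σ) := fun i j hij =>
    neg_le_neg_iff.1 (Tuple.monotone_sort (fun i => -β i) hij)
  set v : Fin (n + 1) → Fin d → ℝ := fun i => e (σ i)
  have hrv : Set.range v = vert S := by
    rw [← hr]
    exact σ.surjective.range_comp fun i => (e i : Fin d → ℝ)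
  choose z hz hzg using fun i => hprim (v i) (e (σ i)).2
  have hSv : S = convexHull ℝ (Set.range v) := by rw [hrv, ← hr, hconv]
  have hs1 : ∑ i, (β ∘ σ) i = 1 := (Equiv.sum_comp σ β).trans hβs
  have hs2 : ∑ i, (β ∘ σ) i • v i = 0 :=
    (Equiv.sum_comp σ fun i => β i • (e i : Fin d → ℝ)).trans hβv
  refine ⟨z, v, β ∘ σ, hz, hSv, fun i => hβ _, hσ, hs1, hs2, ?_, ?_⟩
  · have hvec : vectorSpan ℝ S = Submodule.span ℝ S := by
      rw [vectorSpan_eq_span_vsub_set_right ℝ (intrinsicInterior_subset h0)]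
      simp only [vsub_eq_sub, sub_zero, Set.image_id']
    rw [← span_convexHull_range, ← hSv, ← hdim, dim, hvec]
  · intro α h hα hαs heq
    have hmem := sum_smul_mem_intrinsicInterior hq' hs1 hs2 hα hαs
    rw [← hSv, heq] at hmem
    have hlat : ∑ i, (h i : ℝ) • v i ∈ lattice d := by
      refine ⟨∑ i, h i • z i, funext fun k => ?_⟩
      simp [hz]
    have : ∑ i, (h i : ℝ) • v i ∈ ({0} : Set (Fin d → ℝ)) := hlc ▸ ⟨hmem, hlat⟩
    exact this

namespace IsSortedFanoSimplex

variable {d q n : ℕ} {S : Set (Fin d → ℝ)} {z : Fin (n + 1) → Fin d → ℤ}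
  {v : Fin (n + 1) → Fin d → ℝ} {β : Fin (n + 1) → ℝ}

lemma mem_span_of_ne (hS : IsSortedFanoSimplex q n S z v β) {W : Submodule ℝ (Fin d → ℝ)}
    {k : Fin (n + 1)} (h : ∀ i, i ≠ k → v i ∈ W) : v k ∈ W := by
  have h1 := hS.sum_smul
  rw [← Finset.add_sum_erase _ _ (Finset.mem_univ k)] at h1
  have h2 : β k • v k ∈ W := by
    rw [eq_neg_of_add_eq_zero_left h1]
    exact W.neg_mem (W.sum_mem fun i hi => W.smul_mem _ (h i (Finset.ne_of_mem_erase hi)))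
  exact (W.smul_mem_iff (hS.pos k).ne').1 h2

/-- The relation `∑ β_i v_i = 0` with `β k ≠ 0` recovers `v k`, so the remaining `n` vertices span
the same `n`-dimensional space. -/
lemma linearIndependent_ne (hS : IsSortedFanoSimplex q n S z v β) (k : Fin (n + 1)) :
    LinearIndependent ℝ fun i : {i // i ≠ k} => v i := by
  have hspan : Submodule.span ℝ (Set.range fun i : {i // i ≠ k} => v i)
      = Submodule.span ℝ (Set.range v) := by
    refine le_antisymm (Submodule.span_mono ?_) (Submodule.span_le.2 ?_)
    · rintro _ ⟨i, rfl⟩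
      exact ⟨i, rfl⟩
    · have hne : ∀ i, i ≠ k → v i ∈ Submodule.span ℝ (Set.range fun i : {i // i ≠ k} => v i) :=
        fun i hi => Submodule.subset_span ⟨⟨i, hi⟩, rfl⟩
      rintro _ ⟨i, rfl⟩
      by_cases hi : i = k
      · rw [hi]
        exact hS.mem_span_of_ne hne
      · exact hne i hi
  rw [linearIndependent_iff_card_eq_finrank_span, Set.finrank, hspan, hS.finrank_span]
  simp [Fintype.card_subtype_compl]

lemma linearIndependent_finset (hS : IsSortedFanoSimplex q n S z v β) {J : Finset (Fin (n + 1))}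
    {k : Fin (n + 1)} (hk : k ∉ J) : LinearIndependent ℝ fun i : J => v i :=
  (hS.linearIndependent_ne k).comp (fun i : J => ⟨i, fun h => hk (h ▸ i.2)⟩)
    fun _ _ h => Subtype.ext (Subtype.mk.inj h)

/-- The barycentric coordinates, extended by zero to all natural indices. -/
lemma tail_bounds (hS : IsSortedFanoSimplex q n S z v β) (hq : 0 < q) :
    ∃ b : ℕ → ℝ, (∀ i : Fin (n + 1), b i = β i) ∧ (∀ i ≤ n, 0 < b i) ∧
      (∀ i < n, b (i + 1) ≤ b i) ∧ ∑ i ∈ Finset.range (n + 1), b i = 1 ∧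
      ∀ j ≤ n, q / uReal q j ≤ 1 - ∑ i ∈ Finset.range j, b i := by
  let b : ℕ → ℝ := fun i => if h : i < n + 1 then β ⟨i, h⟩ else 0
  have hb : ∀ i : Fin (n + 1), b i = β i := fun i => dif_pos i.2
  have hb' : ∀ i (h : i < n + 1), b i = β ⟨i, h⟩ := fun i h => hb ⟨i, h⟩
  have hpos : ∀ i ≤ n, 0 < b i := fun i hi => by rw [hb' i (by omega)]; exact hS.pos _
  have hanti : ∀ i < n, b (i + 1) ≤ b i := fun i hi => by
    rw [hb' i (by omega), hb' (i + 1) (by omega)]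
    exact hS.anti (Fin.mk_le_mk.2 (by omega))
  refine ⟨b, hb, hpos, hanti, ?_, div_uReal_le_tail hq hpos hanti fun j hj => ?_⟩
  · rw [Finset.sum_range]
    simp only [hb, hS.sum_eq]
  -- For `j ≤ n` the first `j` indices omit the last one, so they form a proper, independent
  -- subfamily.
  · let J : Finset (Fin (n + 1)) := Finset.univ.filter fun i => (i : ℕ) < j
    have hlast : Fin.last n ∉ J := by simp [J, hj]
    have key := prod_div_le_one_sub_sum hq hS.pos hS.sum_eq hS.sum_smul hS.lc
      (hS.linearIndependent_finset hlast) (fun h => hlast (h ▸ Finset.mem_univ _))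
    have hmap : J.map Fin.valEmbedding = Finset.range j := by
      ext i
      simp only [J, Finset.mem_map, Finset.mem_filter, Finset.mem_univ, true_and, Finset.mem_range,
        Fin.valEmbedding_apply]
      exact ⟨by rintro ⟨a, ha, rfl⟩; exact ha, fun h => ⟨⟨i, by omega⟩, h, rfl⟩⟩
    rw [← hmap, Finset.prod_map, Finset.sum_map]
    simpa only [Fin.valEmbedding_apply, hb] using key

end IsSortedFanoSimplex

/-! ### Volumes of simplices and prisms -/

/-- The volume of the standard simplex, via the cross polytope it tiles by reflections. -/
lemma volume_simplex_le (ι : Type*) [Fintype ι] [Nonempty ι] :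
    volume {x : ι → ℝ | (∀ i, 0 ≤ x i) ∧ ∑ i, x i ≤ 1} ≤
      ENNReal.ofReal (1 / (Fintype.card ι).factorial) := by
  classical
  -- Strict positivity makes the reflected copies disjoint; the discarded part lies in coordinate
  -- hyperplanes, which are null.
  set T : Set (ι → ℝ) := {x | (∀ i, 0 < x i) ∧ ∑ i, x i ≤ 1}
  have hTm : MeasurableSet T := by
    refine MeasurableSet.inter (s₁ := {x : ι → ℝ | ∀ i, 0 < x i})
      (s₂ := {x : ι → ℝ | ∑ i, x i ≤ 1}) ?_ ?_
    · rw [Set.ofPred_forall]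
      exact MeasurableSet.iInter fun i => measurableSet_lt measurable_const (measurable_pi_apply i)
    · exact measurableSet_le (by fun_prop) measurable_const
  let r : (ι → ℤˣ) → (ι → ℝ) → ι → ℝ := fun s x i => ((s i : ℤ) : ℝ) * x i
  have hr : ∀ s, MeasurePreserving (r s) := fun s => by
    refine volume_preserving_pi (f := fun i x => ((s i : ℤ) : ℝ) * x) fun i => ?_
    rcases Int.units_eq_one_or (s i) with h | h
    · simp only [h, Units.val_one, Int.cast_one, one_mul]
      exact MeasurePreserving.id volume
    · simpa [h] using Measure.measurePreserving_neg (volume : Measure ℝ)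
  have hdisj : Pairwise (Function.onFun Disjoint fun s => r s ⁻¹' T) := fun s t hst => by
    refine Set.disjoint_left.2 fun x hs ht => hst (funext fun i => ?_)
    have h1 : 0 < ((s i : ℤ) : ℝ) * x i := hs.1 i
    have h2 : 0 < ((t i : ℤ) : ℝ) * x i := ht.1 i
    rcases Int.units_eq_one_or (s i) with h | h <;> rcases Int.units_eq_one_or (t i) with h' | h' <;>
      rw [h, h'] <;> simp [h, h'] at h1 h2 <;> linarith
  have hcross := volume_sum_rpow_le ι (p := 1) le_rfl 1
  have hsub : (⋃ s, r s ⁻¹' T) ⊆ {x : ι → ℝ | (∑ i, |x i| ^ (1 : ℝ)) ^ (1 / (1 : ℝ)) ≤ 1} := by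
    refine Set.iUnion_subset fun s x hx => ?_
    have h : ∀ i, |x i| = ((s i : ℤ) : ℝ) * x i := fun i => by
      have h1 : 0 < ((s i : ℤ) : ℝ) * x i := hx.1 i
      rcases Int.units_eq_one_or (s i) with h | h
      · simp only [h, Units.val_one, Int.cast_one, one_mul] at h1 ⊢
        exact abs_of_pos h1
      · simp only [h, Units.val_neg, Units.val_one, Int.cast_neg, Int.cast_one, neg_mul,
          one_mul] at h1 ⊢
        exact abs_of_neg (by linarith)
    simp only [Set.mem_ofPred_eq, Real.rpow_one, div_one, h]
    exact hx.2
  have hT : 2 ^ Fintype.card ι * volume T ≤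
      2 ^ Fintype.card ι * ENNReal.ofReal (1 / (Fintype.card ι).factorial) := by
    calc 2 ^ Fintype.card ι * volume T = ∑ s, volume (r s ⁻¹' T) := by
          simp [(hr _).measure_preimage hTm.nullMeasurableSet]
      _ = volume (⋃ s, r s ⁻¹' T) := by
          rw [measure_iUnion hdisj fun s => (hr s).measurable hTm, tsum_fintype]
      _ ≤ _ := measure_mono hsub
      _ = _ := by
          rw [hcross]
          simp only [div_one, ENNReal.ofReal_one, one_pow, one_mul]
          rw [Real.Gamma_nat_eq_factorial, one_add_one_eq_two, Real.Gamma_two, mul_one,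
            show (2 : ENNReal) = ENNReal.ofReal 2 by simp, ← ENNReal.ofReal_pow (by norm_num),
            ← ENNReal.ofReal_mul (by positivity), mul_one_div]
  have hT' := (ENNReal.mul_le_mul_iff_right (by simp) (by finiteness)).1 hT
  have hcover : {x : ι → ℝ | (∀ i, 0 ≤ x i) ∧ ∑ i, x i ≤ 1} ⊆ T ∪ ⋃ i, {x | x i = 0} := by
    intro x hx
    by_cases h : ∃ i, x i = 0
    · exact Or.inr (Set.mem_iUnion.2 h)
    · push Not at h
      exact Or.inl ⟨fun i => (hx.1 i).lt_of_ne' (h i), hx.2⟩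
  have hnull : volume (⋃ i, {x : ι → ℝ | x i = 0}) = 0 :=
    measure_iUnion_null fun i => Measure.pi_hyperplane (fun _ => volume) i 0
  calc _ ≤ volume (T ∪ ⋃ i, {x : ι → ℝ | x i = 0}) := measure_mono hcover
    _ ≤ volume T + volume (⋃ i, {x : ι → ℝ | x i = 0}) := measure_union_le _ _
    _ ≤ _ := by rw [hnull, add_zero]; exact hT'

/-- The volume of a prism over the standard simplex. -/
lemma volume_prism_le {n : ℕ} (hn : 0 < n) :
    volume {x : Fin (n + 1) → ℝ | ((∀ i : Fin n, 0 ≤ x i.castSucc) ∧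
      ∑ i : Fin n, x i.castSucc ≤ 1) ∧ x (Fin.last n) ∈ Set.Icc (0 : ℝ) 1} ≤
      ENNReal.ofReal (1 / n.factorial) := by
  have : Nonempty (Fin n) := ⟨⟨0, hn⟩⟩
  have hmp := volume_preserving_piFinSuccAbove (fun _ : Fin (n + 1) => ℝ) (Fin.last n)
  have hpre : {x : Fin (n + 1) → ℝ | ((∀ i : Fin n, 0 ≤ x i.castSucc) ∧
      ∑ i : Fin n, x i.castSucc ≤ 1) ∧ x (Fin.last n) ∈ Set.Icc (0 : ℝ) 1} =
      MeasurableEquiv.piFinSuccAbove (fun _ => ℝ) (Fin.last n) ⁻¹'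
        (Set.Icc 0 1 ×ˢ {x | (∀ i, 0 ≤ x i) ∧ ∑ i, x i ≤ 1}) := by
    ext x
    simp [MeasurableEquiv.piFinSuccAbove, Fin.insertNthEquiv, Fin.init, and_comm]
  rw [hpre, hmp.measure_preimage_equiv, Measure.volume_eq_prod, Measure.prod_prod,
    Real.volume_Icc, sub_zero, ENNReal.ofReal_one, one_mul]
  simpa using volume_simplex_le (Fin n)

/-- An integral change of coordinates bounds the volume of a set cut out by weighted
inequalities. -/
lemma volume_le_of_weighted_inequalities {n : ℕ} (hn : 0 < n)
    {N : Matrix (Fin (n + 1)) (Fin (n + 1)) ℤ} (hN : N.det ≠ 0) {a : Fin (n + 1) → ℝ}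
    (ha : ∀ i, 0 < a i) {Q : Set (Fin (n + 1) → ℝ)}
    (hQ : ∀ m ∈ Q, ∀ i, 0 ≤ m ⬝ᵥ (fun k => (N i k : ℝ)) + 1)
    (hQs : ∀ m ∈ Q, ∑ i : Fin n,
      a i.castSucc * (m ⬝ᵥ (fun k => (N i.castSucc k : ℝ)) + 1) ≤ 1)
    (hQl : ∀ m ∈ Q, a (Fin.last n) * (m ⬝ᵥ (fun k => (N (Fin.last n) k : ℝ)) + 1) ≤ 1) :
    volume Q ≤ ENNReal.ofReal (1 / (n.factorial * ∏ i, a i)) := by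
  set A : Matrix (Fin (n + 1)) (Fin (n + 1)) ℝ := Matrix.of fun i k => a i * (N i k : ℝ)
  have hprod : 0 < ∏ i, a i := Finset.prod_pos fun i _ => ha i
  have hdet : A.det = (∏ i, a i) * (N.det : ℝ) := by
    rw [Int.cast_det, ← Matrix.det_mul_column]
    rfl
  have hNabs : (1 : ℝ) ≤ |(N.det : ℝ)| := by exact_mod_cast Int.one_le_abs hN
  have hAabs : ∏ i, a i ≤ |A.det| := by
    rw [hdet, abs_mul, abs_of_pos hprod]
    exact le_mul_of_one_le_right hprod.le hNabs
  set f := Matrix.toLin' A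
  have hf : LinearMap.det f ≠ 0 := by
    rw [LinearMap.det_toLin']
    exact abs_pos.1 (hprod.trans_le hAabs)
  have hfa : ∀ m i, f m i + a i = a i * (m ⬝ᵥ (fun k => (N i k : ℝ)) + 1) := fun m i => by
    rw [mul_add, mul_one, add_left_inj]
    simp only [f, A, Matrix.toLin'_apply, Matrix.mulVec, dotProduct, Matrix.of_apply,
      Finset.mul_sum]
    exact Finset.sum_congr rfl fun k _ => by ring
  set K : Set (Fin (n + 1) → ℝ) := {x | ((∀ i : Fin n, 0 ≤ x i.castSucc) ∧
      ∑ i : Fin n, x i.castSucc ≤ 1) ∧ x (Fin.last n) ∈ Set.Icc (0 : ℝ) 1}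
  have hsub : Q ⊆ f ⁻¹' ((fun x => x + a) ⁻¹' K) := fun m hm => by
    have hnn : ∀ i, 0 ≤ f m i + a i := fun i => by
      rw [hfa]
      exact mul_nonneg (ha i).le (hQ m hm i)
    refine ⟨⟨fun i => hnn _, ?_⟩, hnn _, ?_⟩
    · simp only [Pi.add_apply, hfa]
      exact hQs m hm
    · simp only [Pi.add_apply, hfa]
      exact hQl m hm
  calc volume Q ≤ volume (f ⁻¹' ((fun x => x + a) ⁻¹' K)) := measure_mono hsub
    _ = ENNReal.ofReal |(LinearMap.det f)⁻¹| * volume K := by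
        rw [Measure.addHaar_preimage_linearMap _ hf, measure_preimage_add_right]
    _ ≤ ENNReal.ofReal (∏ i, a i)⁻¹ * ENNReal.ofReal (1 / n.factorial) := by
        gcongr
        · rw [LinearMap.det_toLin', abs_inv]
          exact inv_anti₀ hprod hAabs
        · exact volume_prism_le hn
    _ = _ := by
        rw [← ENNReal.ofReal_mul (inv_nonneg.2 hprod.le)]
        congr 1
        field_simp

/-! ### The dual polytope inside a prism -/

namespace IsSortedFanoSimplex

variable {d q n : ℕ} {S : Set (Fin d → ℝ)} {z : Fin (n + 1) → Fin d → ℤ}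
  {v : Fin (n + 1) → Fin d → ℝ} {β : Fin (n + 1) → ℝ}

lemma mem (hS : IsSortedFanoSimplex q n S z v β) (i : Fin (n + 1)) : v i ∈ S :=
  hS.eq_convexHull ▸ subset_convexHull ℝ _ (Set.mem_range_self i)

lemma subset_submodule (hS : IsSortedFanoSimplex q n S z v β) {W : Submodule ℝ (Fin d → ℝ)}
    (h : ∀ i, v i ∈ W) : S ⊆ W := by
  rw [hS.eq_convexHull]
  refine convexHull_min ?_ W.convex
  rintro _ ⟨i, rfl⟩
  exact h i

/-- Pairing with `m` kills `∑ β_i v_i`, leaving the total weight. This identity bounds the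
nonnegative slacks of a dual point from above. -/
lemma sum_mul_dotProduct_add_one (hS : IsSortedFanoSimplex q n S z v β) (m : Fin d → ℝ) :
    ∑ i, β i * (m ⬝ᵥ v i + 1) = 1 := by
  have h : ∑ i, β i * (m ⬝ᵥ v i) = 0 := by
    have := congrArg (fun x => m ⬝ᵥ x) hS.sum_smul
    simpa [dotProduct_sum] using this
  simp only [mul_add, mul_one, Finset.sum_add_distrib, hS.sum_eq, h, zero_add]

end IsSortedFanoSimplex

/-- If two simplices span together a full-dimensional polytope around the origin, some vertex of
the second one, other than the last, lies outside the span of the first one. -/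
lemma exists_ne_last_notMem_span {n q : ℕ} {P S₁ S₂ : Set (Fin (n + 1) → ℝ)}
    {z₁ z₂ : Fin (n + 1) → Fin (n + 1) → ℤ} {v₁ v₂ : Fin (n + 1) → Fin (n + 1) → ℝ}
    {β₁ β₂ : Fin (n + 1) → ℝ} (h₁ : IsSortedFanoSimplex q n S₁ z₁ v₁ β₁)
    (h₂ : IsSortedFanoSimplex q n S₂ z₂ v₂ β₂) (h0 : (0 : Fin (n + 1) → ℝ) ∈ interior P)
    (hP : P = convexHull ℝ (S₁ ∪ S₂)) :
    ∃ k, k ≠ Fin.last n ∧ v₂ k ∉ Submodule.span ℝ (Set.range v₁) := by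
  by_contra! hcon
  set W := Submodule.span ℝ (Set.range v₁)
  -- The last vertex is a combination of the others, so excluding it costs nothing; then `P` would
  -- lie in the `n`-dimensional space `W`, against its nonempty interior.
  have hall : ∀ k, v₂ k ∈ W := fun k => by
    by_cases hk : k = Fin.last n
    · rw [hk]
      exact h₂.mem_span_of_ne hcon
    · exact hcon k hk
  have hPW : P ⊆ W := by
    rw [hP]
    exact convexHull_min (Set.union_subset
      (h₁.subset_submodule fun i => Submodule.subset_span (Set.mem_range_self i))
      (h₂.subset_submodule hall)) W.convex
  have htop : W = ⊤ := W.eq_top_of_nonempty_interior' ⟨0, interior_mono hPW h0⟩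
  have := h₁.finrank_span
  rw [show Submodule.span ℝ (Set.range v₁) = W from rfl, htop, finrank_top,
    Module.finrank_fin_fun] at this
  omega

/-- Dropping nonnegative terms from the two weighted slack identities leaves a simplex condition on
the first `n` vertices of `S₁` and an interval condition on `v₂ k`. The condition `hk` makes these
`n + 1` vertices independent. -/
lemma volume_dual_le {n q : ℕ} (hn : 0 < n) {P S₁ S₂ : Set (Fin (n + 1) → ℝ)}
    {z₁ z₂ : Fin (n + 1) → Fin (n + 1) → ℤ} {v₁ v₂ : Fin (n + 1) → Fin (n + 1) → ℝ}
    {β₁ β₂ : Fin (n + 1) → ℝ} (h₁ : IsSortedFanoSimplex q n S₁ z₁ v₁ β₁)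
    (h₂ : IsSortedFanoSimplex q n S₂ z₂ v₂ β₂) (hS₁ : S₁ ⊆ P) (hS₂ : S₂ ⊆ P) {k : Fin (n + 1)}
    (hk : v₂ k ∉ Submodule.span ℝ (Set.range v₁)) :
    volume (dual P) ≤
      ENNReal.ofReal (1 / (n.factorial * ((∏ i : Fin n, β₁ i.castSucc) * β₂ k))) := by
  set N : Matrix (Fin (n + 1)) (Fin (n + 1)) ℤ :=
    Matrix.of (Fin.snoc (fun i : Fin n => z₁ i.castSucc) (z₂ k) : Fin (n + 1) → Fin (n + 1) → ℤ)
  set a : Fin (n + 1) → ℝ := Fin.snoc (fun i : Fin n => β₁ i.castSucc) (β₂ k)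
  have hNc : ∀ i : Fin n, (fun j => (N i.castSucc j : ℝ)) = v₁ i.castSucc := fun i => by
    simp [N, h₁.cast]
  have hNl : (fun j => (N (Fin.last n) j : ℝ)) = v₂ k := by simp [N, h₂.cast]
  have hac : ∀ i : Fin n, a i.castSucc = β₁ i.castSucc := fun i => by simp [a]
  have hal : a (Fin.last n) = β₂ k := by simp [a]
  have hN : N.det ≠ 0 := by
    have hli : LinearIndependent ℝ (N.map fun x => (x : ℝ)).row := by
      have hrow : (N.map fun x => (x : ℝ)).row = Fin.snoc (fun i : Fin n => v₁ i.castSucc) (v₂ k) := by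
        funext i
        refine Fin.lastCases ?_ (fun i => ?_) i
        · rw [Fin.snoc_last]; exact hNl
        · rw [Fin.snoc_castSucc]; exact hNc i
      rw [hrow, linearIndependent_finSnoc]
      refine ⟨(h₁.linearIndependent_ne (Fin.last n)).comp
        (fun i : Fin n => ⟨i.castSucc, (Fin.castSucc_lt_last i).ne⟩)
        fun _ _ h => Fin.castSucc_injective n (Subtype.mk.inj h), fun h => hk ?_⟩
      refine Submodule.span_mono ?_ h
      rintro _ ⟨i, rfl⟩
      exact Set.mem_range_self _
    have hu := (Matrix.isUnit_iff_isUnit_det _).1 (Matrix.linearIndependent_rows_iff_isUnit.1 hli)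
    have := Int.cast_det (R := ℝ) N
    intro h
    rw [h, Int.cast_zero] at this
    exact hu.ne_zero this.symm
  have ha : ∀ i, 0 < a i := fun i => by
    refine Fin.lastCases ?_ (fun i => ?_) i
    · rw [hal]; exact h₂.pos k
    · rw [hac]; exact h₁.pos _
  have hprod : ∏ i, a i = (∏ i : Fin n, β₁ i.castSucc) * β₂ k := by
    rw [Fin.prod_univ_castSucc, hal]
    simp only [hac]
  rw [← hprod]
  have hf₁ : ∀ m ∈ dual P, ∀ i, 0 ≤ m ⬝ᵥ v₁ i + 1 := fun m hm i => hm _ (hS₁ (h₁.mem i))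
  have hf₂ : ∀ m ∈ dual P, ∀ i, 0 ≤ m ⬝ᵥ v₂ i + 1 := fun m hm i => hm _ (hS₂ (h₂.mem i))
  refine volume_le_of_weighted_inequalities hn hN ha (fun m hm i => ?_) (fun m hm => ?_)
    fun m hm => ?_
  · refine Fin.lastCases ?_ (fun i => ?_) i
    · rw [hNl]; exact hf₂ m hm k
    · rw [hNc]; exact hf₁ m hm _
  · simp only [hac, hNc]
    refine le_of_le_of_eq ?_ (h₁.sum_mul_dotProduct_add_one m)
    rw [Fin.sum_univ_castSucc (n := n)]
    exact le_add_of_nonneg_right (mul_nonneg (h₁.pos _).le (hf₁ m hm _))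
  · rw [hal, hNl]
    refine le_of_le_of_eq ?_ (h₂.sum_mul_dotProduct_add_one m)
    exact Finset.single_le_sum (f := fun i => β₂ i * (m ⬝ᵥ v₂ i + 1))
      (fun i _ => mul_nonneg (h₂.pos i).le (hf₂ m hm i)) (Finset.mem_univ k)

/-- The tail from index `m` consists of the two smallest weights, so the larger of them is at least
half of `q / uReal q m`; every weight except the last is at least as large. -/
lemma IsSortedFanoSimplex.div_le_of_ne_last {d q m : ℕ} (hq : 0 < q) {S : Set (Fin d → ℝ)}
    {z : Fin (m + 1 + 1) → Fin d → ℤ} {v : Fin (m + 1 + 1) → Fin d → ℝ}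
    {β : Fin (m + 1 + 1) → ℝ} (hS : IsSortedFanoSimplex q (m + 1) S z v β)
    {k : Fin (m + 1 + 1)} (hk : k ≠ Fin.last (m + 1)) : q / (2 * uReal q m) ≤ β k := by
  obtain ⟨b, hb, -, hanti, hsum, htail⟩ := hS.tail_bounds hq
  have h1 := (htail m (by omega)).trans (one_sub_sum_le_mul hanti hsum (by omega))
  rw [show m + 1 + 1 - m = 2 by omega, hb ⟨m, by omega⟩] at h1
  have h2 : β ⟨m, by omega⟩ ≤ β k := hS.anti (by
    have := Fin.val_lt_last hk
    rw [Fin.le_def]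
    simp only
    omega)
  have hU := uReal_pos hq m
  rw [div_le_iff₀ hU] at h1
  rw [div_le_iff₀ (by positivity)]
  push_cast at h1
  nlinarith

end LCFano

theorem proposition5p4 (d q : ℕ) (hd : 3 ≤ d) (hq : 2 ≤ q) (P : Set (Fin d → ℝ))
    (hP : LCFano.IsMinimalLCFanoPolytope (1 / (q : ℝ)) P)
    (hns : ¬ LCFano.IsSimplex d P)
    (hdec : LCFano.DecomposesIntoTwo (1 / (q : ℝ)) (d - 1) (d - 1) P) :
    LCFano.normalizedVolume (LCFano.dual P) <
      ENNReal.ofReal (2 * (LCFano.u q d : ℝ) ^ 2 / (q : ℝ) ^ (d + 1)) := by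
  obtain ⟨m, rfl⟩ : ∃ m, d = m + 1 + 1 := ⟨d - 2, by omega⟩
  have hq0 : 0 < q := by omega
  have hqr : (0 : ℝ) < q := by exact_mod_cast hq0
  obtain ⟨S₁, S₂, hS₁, hS₂, -, -, hPS⟩ := hdec
  rw [Nat.add_sub_cancel] at hS₁ hS₂
  obtain ⟨z₁, v₁, β₁, h₁⟩ := hS₁.exists_sorted hq0
  obtain ⟨z₂, v₂, β₂, h₂⟩ := hS₂.exists_sorted hq0
  obtain ⟨k, hk, hkW⟩ := LCFano.exists_ne_last_notMem_span h₁ h₂ hP.1.zero_mem hPS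
  have hvol := LCFano.volume_dual_le (Nat.succ_pos m) h₁ h₂
    (hPS ▸ Set.subset_union_left.trans (subset_convexHull ℝ _))
    (hPS ▸ Set.subset_union_right.trans (subset_convexHull ℝ _)) hkW
  have hβk := h₂.div_le_of_ne_last hq0 hk
  obtain ⟨b, hb, hbpos, hanti, hsum, htail⟩ := h₁.tail_bounds hq0
  have key := LCFano.lt_mul_prod_weights hq (by omega) hbpos hanti hsum htail
  rw [Finset.prod_range, show ∏ i : Fin (m + 1), b i = ∏ i : Fin (m + 1), β₁ i.castSucc from
    Finset.prod_congr rfl fun i _ => hb i.castSucc] at key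
  have hB : 0 < ∏ i : Fin (m + 1), β₁ i.castSucc := Finset.prod_pos fun i _ => h₁.pos _
  have hu : (LCFano.u q (m + 1 + 1) : ℝ) = LCFano.uReal q m * (LCFano.uReal q m + 1) :=
    LCFano.uReal_succ q m
  have hU := LCFano.uReal_pos hq0 m
  rw [hu, LCFano.normalizedVolume]
  -- With `d = m + 2` and indexing from `0`, `W` is `u_{d-1,q}`, so that `u_{d,q} = W * (W + 1)`.
  set W := LCFano.uReal q m
  set B := ∏ i : Fin (m + 1), β₁ i.castSucc
  have hc : 0 < q / (2 * W) := by positivity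
  have hF : (0 : ℝ) < (m + 1).factorial := by exact_mod_cast Nat.factorial_pos _
  calc ((m + 1 + 1).factorial : ENNReal) * MeasureTheory.volume (LCFano.dual P)
      ≤ ((m + 1 + 1).factorial : ENNReal) *
          ENNReal.ofReal (1 / ((m + 1).factorial * (B * β₂ k))) := by gcongr
    _ = ENNReal.ofReal ((m + 1 + 1).factorial * (1 / ((m + 1).factorial * (B * β₂ k)))) := by
        rw [ENNReal.ofReal_mul (by positivity), ENNReal.ofReal_natCast]
    _ ≤ ENNReal.ofReal ((m + 1 + 1).factorial *
          (1 / ((m + 1).factorial * (B * (q / (2 * W)))))) := by gcongr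
    _ < _ := by
        refine (ENNReal.ofReal_lt_ofReal_iff (by positivity)).2 ?_
        rw [Nat.factorial_succ (m + 1)]
        push_cast
        have h1 : ((m : ℝ) + 1 + 1) * (m + 1).factorial *
            (1 / ((m + 1).factorial * (B * (q / (2 * W))))) = 2 * W * (m + 2) / (q * B) := by
          field_simp
          ring
        rw [h1, div_lt_div_iff₀ (by positivity) (by positivity)]
        -- After `d! / (d - 1)! = m + 2` and `β₂ k ≥ q / (2 * W)`, the claim reduces to `key`
        -- multiplied by `2 * W * q`.
        calc 2 * W * (m + 2) * (q : ℝ) ^ (m + 1 + 1 + 1)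
            = 2 * W * q * ((m + 2) * (q : ℝ) ^ (m + 2)) := by ring
          _ < 2 * W * q * (W * (W + 1) ^ 2 * B) := by gcongr
          _ = _ := by ring
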